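/- Let $m \ge 2$ and $N = 2^{m-1}$, and let $D = D_{2^m} = \langle a, b \mid a^{N} = b^2 = e,\ aba = b\rangle$ be the dihedral group of order $2^m$ (for $m=2$ this is the Klein four-group). Put $\Sigma = \sum_{i=0}^{N-1} a^i \in \mathbb{Z}[D]$. Consider the algebraic $2$-complex of free right $\mathbb{Z}[D]$-modules associated with the Cayley complex of this presentation, $$\mathbb{Z}[D]^3 \xrightarrow{\ \partial_2\ } \mathbb{Z}[D]^2 \xrightarrow{\ \partial_1\ } \mathbb{Z}[D] \xrightarrow{\ \varepsilon\ } \mathbb{Z} \to 0,$$ where $\varepsilon$ is the augmentation, $\partial_1 e_1 = a-1$, $\partial_1 e_2 = b-1$, and $$\partial_2 E_1 = e_1\Sigma,\qquad \partial_2 E_2 = e_2(1+b),\qquad \partial_2 E_3 = e_1(1+ba)+e_2(a-1).$$ This sequence is exact at $\mathbb{Z}[D]^2$, $\mathbb{Z}[D]$ and $\mathbb{Z}$. Let $J = \ker \partial_2$. For a $\mathbb{Z}[D]$-linear map $\alpha\colon J \to J$ there is a chain map from the complex to itself that restricts to $\alpha$ on $J$; it induces multiplication by some integer $k$ on $\operatorname{coker}\partial_1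 \cong \mathbb{Z}$, and the class of $k$ modulo $|D| = 2^m$ depends only on $\alpha$. This class is the $k$-invariant $k_\alpha$ of $\alpha$, and $\alpha \mapsto k_\alpha$ is a ring homomorphism $\operatorname{End}(J) \to \mathbb{Z}/2^m$. The Swan map is the induced group homomorphism $$\operatorname{Aut}(J) \to (\mathbb{Z}/2^m)^*,\qquad \alpha \mapsto k_\alpha .$$ Then the Swan map $\operatorname{Aut}(J) \to (\mathbb{Z}/2^m)^*$ is surjective, for every $m \ge 2$. -/

import Mathlib

open MulOpposite

/-- The ring over which right `ℤ[G]`-modules are (left) modules. -/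
abbrev GroupRingOp (G : Type*) [Group G] : Type _ := (MonoidAlgebra ℤ G)ᵐᵒᵖ

/-- The right translation `x ↦ x · g` on a right `ℤ[G]`-module. -/
noncomputable def rightMul {G : Type*} [Group G] {F : Type*} [AddCommGroup F] [Module (GroupRingOp G) F]
    (g : G) : F →ₗ[ℤ] F :=
  (AddMonoidHom.mk' (fun x : F => (op (MonoidAlgebra.of ℤ G g) : GroupRingOp G) • x)
    (fun x y => smul_add _ x y)).toIntLinearMap

theorem rightMul_apply {G : Type*} [Group G] {F : Type*} [AddCommGroup F]
    [Module (GroupRingOp G) F] (g : G) (x : F) :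
    rightMul g x = (op (MonoidAlgebra.of ℤ G g) : GroupRingOp G) • x := rfl

theorem rightMul_rightMul {G : Type*} [Group G] {F : Type*} [AddCommGroup F]
    [Module (GroupRingOp G) F] (g h : G) (x : F) :
    rightMul h (rightMul g x) = rightMul (g * h) x := by
  simp only [rightMul_apply, smul_smul, map_mul, op_mul]

theorem map_rightMul {G : Type*} [Group G] {F F' : Type*} [AddCommGroup F] [AddCommGroup F']
    [Module (GroupRingOp G) F] [Module (GroupRingOp G) F'] (f : F →ₗ[GroupRingOp G] F')
    (g : G) (x : F) : f (rightMul g x) = rightMul g (f x) := by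
  simp only [rightMul_apply, map_smul]

/-- An additive map that commutes with right translations is linear over the group ring. -/
noncomputable def linearOfEquivariant {G : Type*} [Group G] {F F' : Type*} [AddCommGroup F] [AddCommGroup F']
    [Module (GroupRingOp G) F] [Module (GroupRingOp G) F'] (f : F →ₗ[ℤ] F')
    (hf : ∀ (g : G) (x : F), f (rightMul g x) = rightMul g (f x)) : F →ₗ[GroupRingOp G] F' where
  toFun := f
  map_add' := f.map_add
  map_smul' := by
    intro r x
    induction r using MulOpposite.rec' with
    | h r =>
      simp only [RingHom.id_apply]
      induction r using MonoidAlgebra.induction_on with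
      | of g => exact hf g x
      | add a b ha hb => simp only [op_add, add_smul, map_add, ha, hb]
      | smul n a ha => simp only [op_smul, smul_assoc, map_smul, ha]

/-- A free right `ℤ[G]`-module is free as an abelian group. -/
theorem free_int_of_free {G : Type*} [Group G] (F : Type*) [AddCommGroup F]
    [Module (GroupRingOp G) F] [Module.Free (GroupRingOp G) F] : Module.Free ℤ F := by
  exact Module.Free.trans (S := GroupRingOp G)

theorem finite_int_of_finite {G : Type*} [Group G] [Finite G] (F : Type*) [AddCommGroup F]
    [Module (GroupRingOp G) F] [Module.Finite (GroupRingOp G) F] : Module.Finite ℤ F := by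
  have : Module.Finite ℤ (MonoidAlgebra ℤ G) :=
    Module.Finite.equiv (MonoidAlgebra.coeffLinearEquiv (M := G) (S := ℤ) ℤ).symm
  have : Module.Finite ℤ (GroupRingOp G) := Module.Finite.equiv (opLinearEquiv ℤ)
  exact Module.Finite.trans (GroupRingOp G) F

/-- On a free right `ℤ[G]`-module there is an additive endomorphism of trace one. -/
theorem exists_trace_one {G : Type*} [Group G] [Fintype G] (F : Type*) [AddCommGroup F]
    [Module (GroupRingOp G) F] [Module.Free (GroupRingOp G) F] :
    ∃ t : F →ₗ[ℤ] F, ∀ y : F, ∑ g : G, rightMul g (t (rightMul g⁻¹ y)) = y := by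
  classical
  let b := Module.Free.chooseBasis (GroupRingOp G) F
  -- the coefficient at the identity of `G`
  let c : GroupRingOp G →+ GroupRingOp G :=
    { toFun := fun r => op (MonoidAlgebra.single 1 (r.unop.coeff 1))
      map_zero' := by simp
      map_add' := fun r s => by simp }
  have hc : ∀ r : GroupRingOp G,
      ∑ g : G, op (MonoidAlgebra.of ℤ G g) * c (op (MonoidAlgebra.of ℤ G g⁻¹) * r) = r := by
    intro r
    apply unop_injective
    ext x
    simp [c, Finset.unop_sum]
  let t : F →+ F :=
    { toFun := fun y => b.repr.symm ((b.repr y).mapRange c c.map_zero)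
      map_zero' := by simp
      map_add' := fun x y => by
        rw [← map_add, map_add b.repr, Finsupp.mapRange_add c.map_add] }
  refine ⟨t.toIntLinearMap, fun y => b.repr.injective ?_⟩
  ext i
  simp only [map_sum, Finsupp.coe_finsetSum, Finset.sum_apply]
  refine Eq.trans (Finset.sum_congr rfl fun g _ => ?_) (hc (b.repr y i))
  simp [rightMul_apply, t]

/-- Let `d : F → F'` have range the kernel of a map to a finitely generated free abelian group.
Maps from `F` to a free module that vanish on the kernel of `d` extend along `d`. -/
theorem exists_extension {G : Type*} [Group G] [Finite G] {F F' N Q : Type*}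
    [AddCommGroup F] [AddCommGroup F'] [AddCommGroup N] [AddCommGroup Q]
    [Module (GroupRingOp G) F] [Module (GroupRingOp G) F'] [Module (GroupRingOp G) N]
    [Module.Free (GroupRingOp G) N] [Module.Free ℤ Q] [Module.Finite ℤ Q]
    (d : F →ₗ[GroupRingOp G] F') (q : F' →+ Q) (hq : ∀ y, q y = 0 ↔ ∃ x, d x = y)
    (f : F →ₗ[GroupRingOp G] N) (hf : ∀ x, d x = 0 → f x = 0) :
    ∃ h : F' →ₗ[GroupRingOp G] N, ∀ x, h (d x) = f x := by
  cases nonempty_fintype G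
  obtain ⟨t, ht⟩ := exists_trace_one (G := G) N
  -- `f` descends to an additive map on the range of `d`
  let ψ : LinearMap.range d →ₗ[GroupRingOp G] N :=
    (LinearMap.ker d).liftQ f (fun x hx => hf x hx) ∘ₗ d.quotKerEquivRange.symm.toLinearMap
  have hψ : ∀ x (hx : d x ∈ LinearMap.range d), ψ ⟨d x, hx⟩ = f x := by
    intro x hx
    have : d.quotKerEquivRange.symm ⟨d x, hx⟩ = (LinearMap.ker d).mkQ x :=
      d.quotKerEquivRange_symm_apply_image x hx
    simp only [ψ, LinearMap.comp_apply, LinearEquiv.coe_coe, this]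
    exact (LinearMap.ker d).liftQ_apply f x
  -- the range of `d` is a direct summand of `F'` as an abelian group
  obtain ⟨σ, hσ, hσ₀⟩ : ∃ σ : F' →ₗ[ℤ] F', (∀ y, q (σ y) = q y) ∧ ∀ y, q y = 0 → σ y = 0 := by
    obtain ⟨s, hs⟩ := Module.projective_lifting_property q.toIntLinearMap.rangeRestrict
      LinearMap.id q.toIntLinearMap.surjective_rangeRestrict
    refine ⟨s ∘ₗ q.toIntLinearMap.rangeRestrict, fun y => ?_, fun y hy => ?_⟩
    · exact congrArg Subtype.val
        (LinearMap.congr_fun hs (q.toIntLinearMap.rangeRestrict y))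
    · have : q.toIntLinearMap.rangeRestrict y = 0 := Subtype.ext hy
      rw [LinearMap.comp_apply, this, map_zero]
  have hσ' : ∀ y, y - σ y ∈ LinearMap.range d := fun y =>
    (hq _).1 (by rw [map_sub, hσ, sub_self])
  let p : F' →+ LinearMap.range d :=
    { toFun := fun y => ⟨y - σ y, hσ' y⟩
      map_zero' := by ext; simp
      map_add' := fun x y => by ext; simp; abel }
  have hp : ∀ x, p (d x) = ⟨d x, LinearMap.mem_range_self d x⟩ := by
    intro x
    have : σ (d x) = 0 := hσ₀ _ ((hq _).2 ⟨x, rfl⟩)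
    ext; simp [p, this]
  let φ : F' →ₗ[ℤ] N := (ψ.toAddMonoidHom.comp p).toIntLinearMap
  have hφ : ∀ x, φ (d x) = f x := by
    intro x
    have : φ (d x) = ψ (p (d x)) := rfl
    rw [this, hp, hψ]
  let Φ : F' →ₗ[ℤ] N := ∑ g : G, rightMul g ∘ₗ t ∘ₗ φ ∘ₗ rightMul g⁻¹
  have hΦ : ∀ y, Φ y = ∑ g : G, rightMul g (t (φ (rightMul g⁻¹ y))) := by
    intro y; simp [Φ]
  refine ⟨linearOfEquivariant Φ fun g y => ?_, fun x => ?_⟩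
  · rw [hΦ, hΦ, map_sum]
    simp only [rightMul_rightMul]
    refine Fintype.sum_equiv (Equiv.mulRight g⁻¹) _ _ fun k => ?_
    simp
  · change Φ (d x) = f x
    rw [hΦ]
    simp only [← map_rightMul d, hφ, map_rightMul f, ht]

/-- An algebraic `2`-complex `F₂ → F₁ → F₀` of finitely generated free right `ℤ[G]`-modules:
it is exact at `F₁`, and `ε` identifies the cokernel of `d₁` with `ℤ` (with trivial action). -/
structure AlgebraicTwoComplex (G : Type*) [Group G] (F₂ F₁ F₀ : Type*)
    [AddCommGroup F₂] [AddCommGroup F₁] [AddCommGroup F₀]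
    [Module (GroupRingOp G) F₂] [Module (GroupRingOp G) F₁] [Module (GroupRingOp G) F₀] where
  free₂ : Module.Free (GroupRingOp G) F₂
  free₁ : Module.Free (GroupRingOp G) F₁
  free₀ : Module.Free (GroupRingOp G) F₀
  finite₂ : Module.Finite (GroupRingOp G) F₂
  finite₁ : Module.Finite (GroupRingOp G) F₁
  finite₀ : Module.Finite (GroupRingOp G) F₀
  d₂ : F₂ →ₗ[GroupRingOp G] F₁
  d₁ : F₁ →ₗ[GroupRingOp G] F₀
  ε : F₀ →+ ℤ
  ε_rightMul : ∀ (g : G) (x : F₀), ε (rightMul g x) = ε x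
  exact₁ : ∀ y : F₁, d₁ y = 0 ↔ ∃ x : F₂, d₂ x = y
  exact₀ : ∀ y : F₀, ε y = 0 ↔ ∃ x : F₁, d₁ x = y
  ε_surjective : Function.Surjective ε

namespace AlgebraicTwoComplex

variable {G : Type*} [Group G] {F₂ F₁ F₀ : Type*}
  [AddCommGroup F₂] [AddCommGroup F₁] [AddCommGroup F₀]
  [Module (GroupRingOp G) F₂] [Module (GroupRingOp G) F₁] [Module (GroupRingOp G) F₀]

/-- The algebraic `π₂` of the complex: the kernel `J` of `d₂`. -/
noncomputable abbrev pi₂ (C : AlgebraicTwoComplex G F₂ F₁ F₀) : Submodule (GroupRingOp G) F₂ :=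
  LinearMap.ker C.d₂

/-- `C.Induces α k`: some chain map from the complex to itself restricts to `α` on `J` and
induces multiplication by `k` on the cokernel `ℤ` of `d₁`. -/
def Induces (C : AlgebraicTwoComplex G F₂ F₁ F₀) (α : C.pi₂ →ₗ[GroupRingOp G] C.pi₂)
    (k : ℤ) : Prop :=
  ∃ (f₂ : F₂ →ₗ[GroupRingOp G] F₂) (f₁ : F₁ →ₗ[GroupRingOp G] F₁)
    (f₀ : F₀ →ₗ[GroupRingOp G] F₀),
    (∀ x, f₁ (C.d₂ x) = C.d₂ (f₂ x)) ∧ (∀ x, f₀ (C.d₁ x) = C.d₁ (f₁ x)) ∧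
    (∀ x : C.pi₂, f₂ x = α x) ∧ (∀ x, C.ε (f₀ x) = k * C.ε x)

theorem exists_induces [Finite G] (C : AlgebraicTwoComplex G F₂ F₁ F₀)
    (α : C.pi₂ →ₗ[GroupRingOp G] C.pi₂) : ∃ k : ℤ, C.Induces α k := by
  have := C.free₂; have := C.free₁; have := C.free₀
  have := C.finite₁; have := C.finite₀
  have := free_int_of_free (G := G) F₁
  have := free_int_of_free (G := G) F₀
  have := finite_int_of_finite (G := G) F₁
  have := finite_int_of_finite (G := G) F₀
  obtain ⟨f₂, h₂⟩ := exists_extension C.pi₂.subtype C.d₂.toAddMonoidHom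
    (fun y => ⟨fun h => ⟨⟨y, h⟩, rfl⟩, by rintro ⟨x, rfl⟩; exact x.2⟩)
    (C.pi₂.subtype ∘ₗ α) (fun x hx => by
      have : x = 0 := Subtype.ext hx
      simp [this])
  obtain ⟨f₁, h₁⟩ := exists_extension C.d₂ C.d₁.toAddMonoidHom C.exact₁ (C.d₂ ∘ₗ f₂)
    (fun x hx => by
      have := h₂ ⟨x, hx⟩
      simp only [Submodule.subtype_apply, LinearMap.comp_apply] at this ⊢
      rw [this]; exact (α ⟨x, hx⟩).2)
  obtain ⟨f₀, h₀⟩ := exists_extension C.d₁ C.ε C.exact₀ (C.d₁ ∘ₗ f₁)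
    (fun x hx => by
      obtain ⟨y, rfl⟩ := (C.exact₁ x).1 hx
      rw [LinearMap.comp_apply, h₁]
      exact (C.exact₁ _).2 ⟨_, rfl⟩)
  obtain ⟨x₀, hx₀⟩ := C.ε_surjective 1
  refine ⟨C.ε (f₀ x₀), f₂, f₁, f₀, h₁, h₀, h₂, fun x => ?_⟩
  have hx : C.ε (x - C.ε x • x₀) = 0 := by simp [hx₀]
  obtain ⟨y, hy⟩ := (C.exact₀ _).1 hx
  have h : C.ε (f₀ (x - C.ε x • x₀)) = 0 := by
    rw [← hy, h₀]; exact (C.exact₀ _).2 ⟨_, rfl⟩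
  rw [map_sub, map_sub, map_zsmul, map_zsmul, sub_eq_zero] at h
  rw [h, smul_eq_mul, mul_comm]

theorem Induces.add {C : AlgebraicTwoComplex G F₂ F₁ F₀}
    {α β : C.pi₂ →ₗ[GroupRingOp G] C.pi₂} {k l : ℤ} (hα : C.Induces α k)
    (hβ : C.Induces β l) : C.Induces (α + β) (k + l) := by
  obtain ⟨f₂, f₁, f₀, h1, h2, h3, h4⟩ := hα
  obtain ⟨g₂, g₁, g₀, h1', h2', h3', h4'⟩ := hβ
  exact ⟨f₂ + g₂, f₁ + g₁, f₀ + g₀, fun x => by simp [h1, h1'], fun x => by simp [h2, h2'],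
    fun x => by simp [h3, h3'], fun x => by simp [h4, h4', add_mul]⟩

theorem Induces.neg {C : AlgebraicTwoComplex G F₂ F₁ F₀}
    {α : C.pi₂ →ₗ[GroupRingOp G] C.pi₂} {k : ℤ} (hα : C.Induces α k) :
    C.Induces (-α) (-k) := by
  obtain ⟨f₂, f₁, f₀, h1, h2, h3, h4⟩ := hα
  exact ⟨-f₂, -f₁, -f₀, fun x => by simp [h1], fun x => by simp [h2],
    fun x => by simp [h3], fun x => by simp [h4]⟩

theorem Induces.mul {C : AlgebraicTwoComplex G F₂ F₁ F₀}
    {α β : C.pi₂ →ₗ[GroupRingOp G] C.pi₂} {k l : ℤ} (hα : C.Induces α k)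
    (hβ : C.Induces β l) : C.Induces (α ∘ₗ β) (k * l) := by
  obtain ⟨f₂, f₁, f₀, h1, h2, h3, h4⟩ := hα
  obtain ⟨g₂, g₁, g₀, h1', h2', h3', h4'⟩ := hβ
  exact ⟨f₂ ∘ₗ g₂, f₁ ∘ₗ g₁, f₀ ∘ₗ g₀, fun x => by simp [h1, h1'], fun x => by simp [h2, h2'],
    fun x => by simp [h3, h3'], fun x => by simp [h4, h4', mul_assoc]⟩

theorem Induces.one (C : AlgebraicTwoComplex G F₂ F₁ F₀) : C.Induces LinearMap.id 1 :=
  ⟨LinearMap.id, LinearMap.id, LinearMap.id, by simp, by simp, by simp, by simp⟩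

theorem Induces.zero (C : AlgebraicTwoComplex G F₂ F₁ F₀) : C.Induces 0 0 :=
  ⟨0, 0, 0, by simp, by simp, by simp, by simp⟩

theorem card_dvd_of_induces_zero [Finite G] (C : AlgebraicTwoComplex G F₂ F₁ F₀) {k : ℤ}
    (h : C.Induces 0 k) : (Nat.card G : ℤ) ∣ k := by
  have := C.free₂; have := C.free₁; have := C.free₀
  have := C.finite₁; have := C.finite₀
  have := free_int_of_free (G := G) F₁
  have := free_int_of_free (G := G) F₀
  have := finite_int_of_finite (G := G) F₁
  have := finite_int_of_finite (G := G) F₀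
  obtain ⟨f₂, f₁, f₀, h1, h2, h3, h4⟩ := h
  obtain ⟨s₁, hs₁⟩ := exists_extension C.d₂ C.d₁.toAddMonoidHom C.exact₁ f₂
    (fun x hx => h3 ⟨x, hx⟩)
  obtain ⟨s₀, hs₀⟩ := exists_extension C.d₁ C.ε C.exact₀ (f₁ - C.d₂ ∘ₗ s₁)
    (fun x hx => by
      obtain ⟨y, rfl⟩ := (C.exact₁ x).1 hx
      simp [hs₁, h1])
  obtain ⟨x₀, hx₀⟩ := C.ε_surjective 1
  have hdd : ∀ x, C.d₁ (C.d₂ x) = 0 := fun x => (C.exact₁ _).2 ⟨x, rfl⟩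
  have hed : ∀ x, C.ε (C.d₁ x) = 0 := fun x => (C.exact₀ _).2 ⟨x, rfl⟩
  have hker : ∀ x, C.ε x = 0 → (f₀ - C.d₁ ∘ₗ s₀) x = 0 := by
    intro x hx
    obtain ⟨y, rfl⟩ := (C.exact₀ x).1 hx
    simp [hs₀, h2, hdd]
  set v := (f₀ - C.d₁ ∘ₗ s₀) x₀ with hv
  have hεv : C.ε v = k := by simp [hv, h4, hed, hx₀]
  have hinv : ∀ g : G, rightMul g v = v := by
    intro g
    rw [hv, ← map_rightMul, ← sub_eq_zero, ← map_sub]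
    exact hker _ (by rw [map_sub, C.ε_rightMul, sub_self])
  cases nonempty_fintype G
  obtain ⟨t, ht⟩ := exists_trace_one (G := G) F₀
  refine ⟨C.ε (t v), ?_⟩
  rw [← hεv]
  conv_lhs => rw [← ht v]
  simp [map_sum, hinv, C.ε_rightMul]

theorem Induces.cast_eq [Finite G] {C : AlgebraicTwoComplex G F₂ F₁ F₀} {n : ℕ}
    (hn : Nat.card G = n) {α : C.pi₂ →ₗ[GroupRingOp G] C.pi₂} {k l : ℤ}
    (hk : C.Induces α k) (hl : C.Induces α l) : (k : ZMod n) = l := by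
  have h := hk.add hl.neg
  have h0 : α + -α = 0 := by ext x; simp
  rw [h0] at h
  have h' := C.card_dvd_of_induces_zero h
  rw [hn, ← ZMod.intCast_zmod_eq_zero_iff_dvd, Int.cast_add, Int.cast_neg] at h'
  rwa [← sub_eq_zero, sub_eq_add_neg]

/-- The ring homomorphism `κ : End(J) → ℤ/n`, `n = |G|`, sending `α` to its `k`-invariant: the
class mod `n` of any `k` such that a chain map inducing `α` on `J` induces multiplication by `k`
on `ℤ`. -/
noncomputable def kappa [Finite G] (C : AlgebraicTwoComplex G F₂ F₁ F₀) {n : ℕ}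
    (hn : Nat.card G = n) : Module.End (GroupRingOp G) C.pi₂ →+* ZMod n where
  toFun α := ((C.exists_induces α).choose : ZMod n)
  map_one' := by
    rw [← Int.cast_one]
    exact Induces.cast_eq hn (C.exists_induces _).choose_spec (Induces.one C)
  map_mul' α β := by
    rw [← Int.cast_mul]
    exact Induces.cast_eq hn (C.exists_induces _).choose_spec
      ((C.exists_induces α).choose_spec.mul (C.exists_induces β).choose_spec)
  map_zero' := by
    rw [← Int.cast_zero]
    exact Induces.cast_eq hn (C.exists_induces _).choose_spec (Induces.zero C)
  map_add' α β := by
    rw [← Int.cast_add]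
    exact Induces.cast_eq hn (C.exists_induces _).choose_spec
      ((C.exists_induces α).choose_spec.add (C.exists_induces β).choose_spec)

theorem kappa_eq_of_induces [Finite G] (C : AlgebraicTwoComplex G F₂ F₁ F₀) {n : ℕ}
    (hn : Nat.card G = n) {α : Module.End (GroupRingOp G) C.pi₂} {k : ℤ}
    (h : C.Induces α k) : C.kappa hn α = k :=
  Induces.cast_eq hn (C.exists_induces _).choose_spec h

/-- The Swan map `Aut(J) → (ℤ/n)ˣ`, `n = |G|`: an automorphism is sent to its `k`-invariant. -/
noncomputable def swanMap [Finite G] (C : AlgebraicTwoComplex G F₂ F₁ F₀) {n : ℕ}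
    (hn : Nat.card G = n) : (C.pi₂ ≃ₗ[GroupRingOp G] C.pi₂) →* (ZMod n)ˣ :=
  (Units.map (C.kappa hn : Module.End (GroupRingOp G) C.pi₂ →* ZMod n)).comp
    (LinearMap.GeneralLinearGroup.generalLinearEquiv (GroupRingOp G) C.pi₂).symm.toMonoidHom

theorem coe_swanMap [Finite G] (C : AlgebraicTwoComplex G F₂ F₁ F₀) {n : ℕ}
    (hn : Nat.card G = n) (α : C.pi₂ ≃ₗ[GroupRingOp G] C.pi₂) :
    (C.swanMap hn α : ZMod n) = C.kappa hn (α : C.pi₂ →ₗ[GroupRingOp G] C.pi₂) := rfl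

end AlgebraicTwoComplex

/-- Left multiplication by a matrix, as a map of free right modules. -/
def matrixMap {R : Type*} [Ring R] {p q : ℕ} (M : Matrix (Fin p) (Fin q) R) :
    (Fin q → R) →ₗ[Rᵐᵒᵖ] (Fin p → R) where
  toFun v := M.mulVec v
  map_add' := M.mulVec_add
  map_smul' c v := by
    ext i
    simp [Matrix.mulVec, dotProduct, Finset.sum_mul, mul_assoc]

/-- A ring, viewed as a right module over itself, is free of rank one. -/
def opSelfEquiv (R : Type*) [Ring R] : R ≃ₗ[Rᵐᵒᵖ] Rᵐᵒᵖ where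
  toFun := op
  invFun := unop
  map_add' _ _ := rfl
  map_smul' _ _ := rfl
  left_inv _ := rfl
  right_inv _ := rfl

namespace DihedralGroup

/-- The generator `a` of `⟨a, b ∣ a ^ N = b ^ 2 = e, a b a = b⟩` (the dihedral group of order
`2 N`) in the integral group ring. -/
noncomputable def ringA (N : ℕ) : MonoidAlgebra ℤ (DihedralGroup N) := MonoidAlgebra.of ℤ _ (r 1)

/-- The generator `b` of `⟨a, b ∣ a ^ N = b ^ 2 = e, a b a = b⟩` in the integral group ring. -/
noncomputable def ringB (N : ℕ) : MonoidAlgebra ℤ (DihedralGroup N) := MonoidAlgebra.of ℤ _ (sr 0)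

/-- `Σ = 1 + a + ⋯ + a ^ (N - 1)`. -/
noncomputable def ringSigma (N : ℕ) : MonoidAlgebra ℤ (DihedralGroup N) :=
  ∑ i ∈ Finset.range N, ringA N ^ i

/-- `∂₁ : ℤ[D]² → ℤ[D]`, the map of right modules with `∂₁ e₁ = a - 1`, `∂₁ e₂ = b - 1`. -/
noncomputable def boundary₁ (N : ℕ) :
    (Fin 2 → MonoidAlgebra ℤ (DihedralGroup N)) →ₗ[GroupRingOp (DihedralGroup N)]
      MonoidAlgebra ℤ (DihedralGroup N) where
  toFun v := (ringA N - 1) * v 0 + (ringB N - 1) * v 1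
  map_add' v w := by simp only [Pi.add_apply, mul_add]; abel
  map_smul' c v := by simp [mul_assoc]

/-- `∂₂ : ℤ[D]³ → ℤ[D]²`, the map of right modules with `∂₂ E₁ = e₁ Σ`, `∂₂ E₂ = e₂ (1 + b)`,
`∂₂ E₃ = e₁ (1 + b a) + e₂ (a - 1)`. -/
noncomputable def boundary₂ (N : ℕ) :
    (Fin 3 → MonoidAlgebra ℤ (DihedralGroup N)) →ₗ[GroupRingOp (DihedralGroup N)]
      (Fin 2 → MonoidAlgebra ℤ (DihedralGroup N)) :=
  matrixMap !![ringSigma N, 0, 1 + ringB N * ringA N; 0, 1 + ringB N, ringA N - 1]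

/-- The augmentation `ℤ[G] → ℤ`, sending every group element to `1`. -/
noncomputable def augmentation (N : ℕ) : MonoidAlgebra ℤ (DihedralGroup N) →ₐ[ℤ] ℤ :=
  MonoidAlgebra.lift ℤ ℤ (DihedralGroup N) 1

theorem augmentation_of {N : ℕ} (g : DihedralGroup N) :
    augmentation N (MonoidAlgebra.of ℤ _ g) = 1 := by
  simp [augmentation]

theorem ringA_pow {N : ℕ} (k : ℕ) : ringA N ^ k = MonoidAlgebra.of ℤ _ (r (k : ZMod N)) := by
  rw [ringA, ← map_pow, r_one_pow]

theorem ringB_mul_ringB (N : ℕ) : ringB N * ringB N = 1 := by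
  rw [ringB, ← map_mul, sr_mul_self, map_one]

theorem ringA_mul_ringB_mul_ringA (N : ℕ) : ringA N * ringB N * ringA N = ringB N := by
  rw [ringA, ringB, ← map_mul, ← map_mul]; simp

theorem ringA_sub_one_mul_ringSigma (N : ℕ) : (ringA N - 1) * ringSigma N = 0 := by
  rw [ringSigma, mul_geom_sum, ringA_pow, CharP.cast_eq_zero, r_zero, map_one, sub_self]

theorem boundary₁_apply {N : ℕ} (v : Fin 2 → MonoidAlgebra ℤ (DihedralGroup N)) :
    boundary₁ N v = (ringA N - 1) * v 0 + (ringB N - 1) * v 1 := rfl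

theorem boundary₂_apply {N : ℕ} (v : Fin 3 → MonoidAlgebra ℤ (DihedralGroup N)) :
    boundary₂ N v = ![ringSigma N * v 0 + (1 + ringB N * ringA N) * v 2,
      (1 + ringB N) * v 1 + (ringA N - 1) * v 2] := by
  ext i : 1
  fin_cases i <;>
    simp [boundary₂, matrixMap, dotProduct, Fin.sum_univ_three]

theorem boundary₁_boundary₂ {N : ℕ} (v : Fin 3 → MonoidAlgebra ℤ (DihedralGroup N)) :
    boundary₁ N (boundary₂ N v) = 0 := by
  have h1 := ringA_sub_one_mul_ringSigma N
  have h2 : (ringB N - 1) * (1 + ringB N) = 0 := by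
    have := ringB_mul_ringB N
    simp only [sub_mul, mul_add, this, one_mul, mul_one]
    abel
  have h3 : (ringA N - 1) * (1 + ringB N * ringA N) + (ringB N - 1) * (ringA N - 1) = 0 := by
    have := ringA_mul_ringB_mul_ringA N
    rw [mul_assoc] at this
    simp only [sub_mul, mul_add, mul_sub, this, one_mul, mul_one]
    abel
  have : (ringA N - 1) * (ringSigma N * v 0 + (1 + ringB N * ringA N) * v 2) +
      (ringB N - 1) * ((1 + ringB N) * v 1 + (ringA N - 1) * v 2) =
      ((ringA N - 1) * ringSigma N) * v 0 + ((ringB N - 1) * (1 + ringB N)) * v 1 +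
      ((ringA N - 1) * (1 + ringB N * ringA N) + (ringB N - 1) * (ringA N - 1)) * v 2 := by
    noncomm_ring
  simp [boundary₁_apply, boundary₂_apply, this, h1, h2, h3]

/-- The partial sums `1 + a + ⋯ + a ^ (k - 1)`. -/
noncomputable def partialSum (N k : ℕ) : MonoidAlgebra ℤ (DihedralGroup N) :=
  ∑ i ∈ Finset.range k, ringA N ^ i

/-- A chain in `F₁` with boundary `g - 1`. -/
noncomputable def fill (N : ℕ) :
    DihedralGroup N → Fin 2 → MonoidAlgebra ℤ (DihedralGroup N)
  | r i => ![partialSum N i.val, 0]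
  | sr i => ![partialSum N (-i).val * ringB N, 1]

theorem boundary₁_fill {N : ℕ} [NeZero N] (g : DihedralGroup N) :
    boundary₁ N (fill N g) = MonoidAlgebra.of ℤ _ g - 1 := by
  rw [boundary₁_apply]
  rcases g with i | i
  · simp only [fill, Matrix.cons_val_zero, Matrix.cons_val_one, mul_zero, add_zero, partialSum]
    rw [mul_geom_sum, ringA_pow, ZMod.natCast_zmod_val]
  · simp only [fill, Matrix.cons_val_zero, Matrix.cons_val_one, mul_one, partialSum]
    rw [← mul_assoc, mul_geom_sum, ringA_pow, ZMod.natCast_zmod_val, sub_mul, one_mul, ringB,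
      ← map_mul, r_mul_sr]
    simp

/-- The additive extension of `fill` to the group ring. -/
noncomputable def fillHom (N : ℕ) : MonoidAlgebra ℤ (DihedralGroup N) →ₗ[ℤ]
    (Fin 2 → MonoidAlgebra ℤ (DihedralGroup N)) :=
  Finsupp.linearCombination ℤ (fill N) ∘ₗ (MonoidAlgebra.coeffLinearEquiv ℤ).toLinearMap

theorem fillHom_of {N : ℕ} (g : DihedralGroup N) :
    fillHom N (MonoidAlgebra.of ℤ _ g) = fill N g := by
  simp [fillHom, MonoidAlgebra.coeffLinearEquiv]

theorem boundary₁_fillHom {N : ℕ} [NeZero N] (y : MonoidAlgebra ℤ (DihedralGroup N)) :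
    boundary₁ N (fillHom N y) = y - augmentation N y • 1 := by
  induction y using MonoidAlgebra.induction_on with
  | of g => rw [fillHom_of, boundary₁_fill, augmentation_of, one_smul]
  | add x y hx hy => rw [map_add, map_add, hx, hy, map_add, add_smul]; abel
  | smul n x hx => rw [map_smul, map_zsmul, hx, map_smul, smul_sub, smul_assoc]

theorem partialSum_step {N : ℕ} [NeZero N] (i : ZMod N) :
    MonoidAlgebra.of ℤ _ (r i) - partialSum N (1 + i).val + partialSum N i.val = 0 ∨
    MonoidAlgebra.of ℤ _ (r i) - partialSum N (1 + i).val + partialSum N i.val = ringSigma N := by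
  have h : partialSum N (i.val + 1) = partialSum N i.val + MonoidAlgebra.of ℤ _ (r i) := by
    rw [partialSum, Finset.sum_range_succ, ringA_pow, ZMod.natCast_zmod_val]; rfl
  have h1 : (1 + i).val = (i.val + 1) % N := by
    rw [← ZMod.val_natCast, Nat.cast_add, ZMod.natCast_zmod_val, Nat.cast_one, add_comm]
  rcases (Nat.succ_le_of_lt (ZMod.val_lt i)).lt_or_eq with hlt | heq
  · left
    rw [h1, Nat.mod_eq_of_lt hlt, h]; abel
  · right
    rw [Nat.succ_eq_add_one] at heq
    have : ringSigma N = partialSum N (i.val + 1) := by rw [heq]; rfl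
    rw [h1, this, h, heq, Nat.mod_self]
    simp [partialSum, add_comm]

theorem of_fill_mem₁ {N : ℕ} [NeZero N] (g : DihedralGroup N) :
    ![MonoidAlgebra.of ℤ _ g, 0] - fill N (r 1 * g) + fill N g ∈
      LinearMap.range (boundary₂ N) := by
  rcases g with i | i
  · have h : ![MonoidAlgebra.of ℤ _ (r i), 0] - fill N (r 1 * r i) + fill N (r i) =
      ![MonoidAlgebra.of ℤ _ (r i) - partialSum N (1 + i).val + partialSum N i.val, 0] := by
      rw [r_mul_r]; simp [fill]
    rw [h]
    rcases partialSum_step i with h | h <;> rw [h]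
    · exact ⟨0, by ext i : 1; fin_cases i <;> simp⟩
    · exact ⟨![1, 0, 0], by rw [boundary₂_apply]; simp⟩
  · have h : ![MonoidAlgebra.of ℤ _ (sr i), 0] - fill N (r 1 * sr i) + fill N (sr i) =
      ![(MonoidAlgebra.of ℤ _ (r (-i)) - partialSum N (1 + -i).val + partialSum N (-i).val) *
        ringB N, 0] := by
      have : MonoidAlgebra.of ℤ _ (sr i) = MonoidAlgebra.of ℤ _ (r (-i)) * ringB N := by
        rw [ringB, ← map_mul]; simp
      rw [r_mul_sr, this]
      simp [fill, add_mul, sub_eq_add_neg]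
    rw [h]
    rcases partialSum_step (-i) with h | h <;> rw [h]
    · exact ⟨0, by ext i : 1; fin_cases i <;> simp⟩
    · exact ⟨![ringB N, 0, 0], by rw [boundary₂_apply]; simp⟩

theorem of_fill_step {N : ℕ} [NeZero N] (g : DihedralGroup N)
    (hg : ![0, MonoidAlgebra.of ℤ _ g] - fill N (sr 0 * g) + fill N g ∈
      LinearMap.range (boundary₂ N)) :
    ![0, MonoidAlgebra.of ℤ _ (r 1 * g)] - fill N (sr 0 * (r 1 * g)) + fill N (r 1 * g) ∈
      LinearMap.range (boundary₂ N) := by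
  have h1 := of_fill_mem₁ g
  have h2 := of_fill_mem₁ (sr 0 * (r 1 * g))
  have h3 : boundary₂ N ![0, 0, MonoidAlgebra.of ℤ _ g] ∈ LinearMap.range (boundary₂ N) := ⟨_, rfl⟩
  have e : r 1 * (sr 0 * (r 1 * g)) = sr 0 * g := by
    rw [← mul_assoc, ← mul_assoc]; simp
  rw [e] at h2
  convert Submodule.sub_mem _ (Submodule.sub_mem _ (Submodule.add_mem _ hg h3) h1) h2 using 1
  rw [boundary₂_apply]
  have e1 : MonoidAlgebra.of ℤ _ (r 1 * g) = ringA N * MonoidAlgebra.of ℤ _ g := by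
    rw [ringA, ← map_mul]
  have e2 : MonoidAlgebra.of ℤ _ (sr 0 * (r 1 * g)) =
      ringB N * ringA N * MonoidAlgebra.of ℤ _ g := by
    rw [ringA, ringB, ← map_mul, ← map_mul, mul_assoc]
  rw [e1, e2]
  ext i : 1
  fin_cases i <;> simp [add_mul, sub_mul] <;> abel

theorem of_fill_mem₂ {N : ℕ} [NeZero N] (g : DihedralGroup N) :
    ![0, MonoidAlgebra.of ℤ _ g] - fill N (sr 0 * g) + fill N g ∈
      LinearMap.range (boundary₂ N) := by
  have key : ∀ (k : ℕ) (g : DihedralGroup N),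
      (![0, MonoidAlgebra.of ℤ _ g] - fill N (sr 0 * g) + fill N g ∈
        LinearMap.range (boundary₂ N)) →
      ![0, MonoidAlgebra.of ℤ _ (r 1 ^ k * g)] - fill N (sr 0 * (r 1 ^ k * g)) +
        fill N (r 1 ^ k * g) ∈ LinearMap.range (boundary₂ N) := by
    intro k g hg
    induction k with
    | zero => simpa using hg
    | succ k ih => rw [pow_succ', mul_assoc]; exact of_fill_step _ ih
  rcases g with i | i
  · have := key i.val 1 ⟨0, by
      rw [mul_one, map_zero, one_def, ← one_def, map_one]
      ext i : 1
      fin_cases i <;> simp [fill, one_def, partialSum, -r_zero]⟩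
    rwa [r_one_pow, ZMod.natCast_zmod_val, mul_one] at this
  · have := key (-i).val (sr 0) ⟨![0, 1, 0], by
      rw [boundary₂_apply, sr_mul_self]
      ext i : 1
      fin_cases i <;> simp [fill, one_def, partialSum, ringB, -r_zero, add_comm]⟩
    rwa [r_one_pow, ZMod.natCast_zmod_val, r_mul_sr, sub_neg_eq_add, zero_add] at this

theorem sub_fillHom_mem {N : ℕ} [NeZero N] (v : Fin 2 → MonoidAlgebra ℤ (DihedralGroup N)) :
    v - fillHom N (boundary₁ N v) ∈ LinearMap.range (boundary₂ N) := by
  have h1 : ∀ x : MonoidAlgebra ℤ (DihedralGroup N),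
      ![x, 0] - fillHom N ((ringA N - 1) * x) ∈ LinearMap.range (boundary₂ N) := by
    intro x
    induction x using MonoidAlgebra.induction_on with
    | of g =>
      convert of_fill_mem₁ g using 1
      rw [sub_mul, one_mul, ringA, ← map_mul, map_sub, fillHom_of, fillHom_of]
      abel
    | add x y hx hy =>
      have h : (![x + y, 0] : Fin 2 → MonoidAlgebra ℤ (DihedralGroup N)) = ![x, 0] + ![y, 0] := by
        simp
      convert Submodule.add_mem _ hx hy using 1
      rw [mul_add, map_add, h]
      abel
    | smul n x hx =>
      have h : (![n • x, 0] : Fin 2 → MonoidAlgebra ℤ (DihedralGroup N)) = n • ![x, 0] := by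
        simp
      convert zsmul_mem hx n using 1
      rw [mul_smul_comm, map_smul, h, smul_sub]
  have h2 : ∀ x : MonoidAlgebra ℤ (DihedralGroup N),
      ![0, x] - fillHom N ((ringB N - 1) * x) ∈ LinearMap.range (boundary₂ N) := by
    intro x
    induction x using MonoidAlgebra.induction_on with
    | of g =>
      convert of_fill_mem₂ g using 1
      rw [sub_mul, one_mul, ringB, ← map_mul, map_sub, fillHom_of, fillHom_of]
      abel
    | add x y hx hy =>
      have h : (![0, x + y] : Fin 2 → MonoidAlgebra ℤ (DihedralGroup N)) = ![0, x] + ![0, y] := by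
        simp
      convert Submodule.add_mem _ hx hy using 1
      rw [mul_add, map_add, h]
      abel
    | smul n x hx =>
      have h : (![0, n • x] : Fin 2 → MonoidAlgebra ℤ (DihedralGroup N)) = n • ![0, x] := by
        simp
      convert zsmul_mem hx n using 1
      rw [mul_smul_comm, map_smul, h, smul_sub]
  convert Submodule.add_mem _ (h1 (v 0)) (h2 (v 1)) using 1
  rw [boundary₁_apply]
  ext i : 1
  fin_cases i <;> simp <;> abel

/-- The algebraic complex `ℤ[D]³ → ℤ[D]² → ℤ[D]` (augmented by `ε : ℤ[D] → ℤ`) of the Cayley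
complex of the presentation `⟨a, b ∣ a ^ N = b ^ 2 = e, a b a = b⟩` of the dihedral group of
order `2 N`. -/
noncomputable def cayleyComplex (N : ℕ) [NeZero N] :
    AlgebraicTwoComplex (DihedralGroup N) (Fin 3 → MonoidAlgebra ℤ (DihedralGroup N))
      (Fin 2 → MonoidAlgebra ℤ (DihedralGroup N)) (MonoidAlgebra ℤ (DihedralGroup N)) :=
  have : Module.Free (GroupRingOp (DihedralGroup N)) (MonoidAlgebra ℤ (DihedralGroup N)) :=
    Module.Free.of_equiv (opSelfEquiv _).symm
  have : Module.Finite (GroupRingOp (DihedralGroup N)) (MonoidAlgebra ℤ (DihedralGroup N)) :=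
    Module.Finite.equiv (opSelfEquiv _).symm
  { free₂ := inferInstance
    free₁ := inferInstance
    free₀ := inferInstance
    finite₂ := inferInstance
    finite₁ := inferInstance
    finite₀ := inferInstance
    d₂ := boundary₂ N
    d₁ := boundary₁ N
    ε := (augmentation N).toRingHom.toAddMonoidHom
    ε_rightMul := fun g x => by
      change augmentation N (x * MonoidAlgebra.of ℤ _ g) = augmentation N x
      rw [map_mul, augmentation_of, mul_one]
    exact₁ := fun y => by
      constructor
      · intro hy
        have := sub_fillHom_mem y
        rw [hy, map_zero, sub_zero] at this
        exact this
      · rintro ⟨x, rfl⟩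
        exact boundary₁_boundary₂ x
    exact₀ := fun y => by
      change augmentation N y = 0 ↔ _
      constructor
      · intro hy
        exact ⟨fillHom N y, by rw [boundary₁_fillHom, hy, zero_smul, sub_zero]⟩
      · rintro ⟨x, rfl⟩
        rw [boundary₁_apply, map_add, map_mul, map_mul, map_sub, map_sub, ringA, ringB,
          augmentation_of, augmentation_of, map_one, sub_self, zero_mul, zero_mul, add_zero]
    ε_surjective := fun k => ⟨k • 1, by
      change augmentation N (k • 1) = k
      simp⟩ }

theorem natCard_two_pow {m : ℕ} (hm : 2 ≤ m) : Nat.card (DihedralGroup (2 ^ (m - 1))) = 2 ^ m := by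
  rw [nat_card, ← pow_succ', Nat.sub_add_cancel (by omega)]

end DihedralGroup

/-! Every unit modulo `2^m` is the class of an odd number `2j+1`, and this number is also prime to
`N`. It is realised by an explicit chain map of left multiplications. In degree 0 it multiplies by
`walkSum`, whose augmentation is `2j+1`. In degree 2 it is diagonal with entries `alternatingSum`,
1, 1. In degree 1 it is upper triangular, with first row `1 + P(a - ba)`, `P(b - 1)`, where `P = 1 +
a + ⋯ + a^(j-1)`. Commutation with the boundaries reduces to `walkSum_mul_ringA_sub_one`,
`walkSum_mul_ringB_sub_one` and `ringSigma_mul_alternatingSum`.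

It remains to see that the map is bijective on `J`. As `J` is a finitely generated abelian group,
surjectivity suffices. Only the first coordinate changes. For an element of `J` this coordinate lies
in the right ideal `M` generated by `1 + b` and `1 + ba`, by `isReflectionSum_of_mul_eq_zero`. Left
multiplication by `alternatingSum` sends these generators to `a^j(1 + b)` and `1 + ba`, which still
generate `M` because `2j+1` is prime to `N` (`IsReflectionSum.exists_alternatingSum_mul_eq`).
Finally, `alternatingSum` does not alter `Σx` for `x` in `M`, so changing the first coordinate to a
preimage in `M` stays inside `J`. -/

/-! ### Chain maps that are surjective on `J` -/

/-- A surjective endomorphism of a submodule of a finitely generated right `ℤ[G]`-module, `G`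
finite, is injective. -/
theorem injective_of_surjective_endomorphism_submodule {G : Type*} [Group G] [Finite G] {F : Type*}
    [AddCommGroup F] [Module (GroupRingOp G) F] [Module.Finite (GroupRingOp G) F]
    (p : Submodule (GroupRingOp G) F) (α : p →ₗ[GroupRingOp G] p)
    (hα : Function.Surjective α) : Function.Injective α := by
  -- Noetherianity is available over `ℤ`, since `G` is finite; linearity over the group ring plays
  -- no further role.
  have := finite_int_of_finite (G := G) F
  have : IsNoetherian ℤ p :=
    isNoetherian_of_injective p.subtype.toAddMonoidHom.toIntLinearMap p.injective_subtype
  exact OrzechProperty.injective_of_surjective_endomorphism α.toAddMonoidHom.toIntLinearMap hα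

namespace AlgebraicTwoComplex

variable {G : Type*} [Group G] {F₂ F₁ F₀ : Type*}
  [AddCommGroup F₂] [AddCommGroup F₁] [AddCommGroup F₀]
  [Module (GroupRingOp G) F₂] [Module (GroupRingOp G) F₁] [Module (GroupRingOp G) F₀]

/-- A chain map that is surjective on `J` and multiplies the augmentation by `k` shows that the
class of `k` is a value of the Swan map. -/
theorem exists_swanMap_eq [Finite G] (C : AlgebraicTwoComplex G F₂ F₁ F₀) {n : ℕ}
    (hn : Nat.card G = n) {k : ℤ} (f₂ : F₂ →ₗ[GroupRingOp G] F₂)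
    (f₁ : F₁ →ₗ[GroupRingOp G] F₁) (f₀ : F₀ →ₗ[GroupRingOp G] F₀)
    (h₁ : ∀ x, f₁ (C.d₂ x) = C.d₂ (f₂ x)) (h₀ : ∀ x, f₀ (C.d₁ x) = C.d₁ (f₁ x))
    (hε : ∀ x, C.ε (f₀ x) = k * C.ε x)
    (hf : ∀ y, C.d₂ y = 0 → ∃ x, C.d₂ x = 0 ∧ f₂ x = y) :
    ∃ α : C.pi₂ ≃ₗ[GroupRingOp G] C.pi₂, (C.swanMap hn α : ZMod n) = k := by
  have := C.finite₂
  have hJ : ∀ x ∈ C.pi₂, f₂ x ∈ C.pi₂ := fun x hx => by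
    rw [LinearMap.mem_ker] at hx ⊢
    rw [← h₁, hx, map_zero]
  have hsurj : Function.Surjective (f₂.restrict hJ) := by
    rintro ⟨y, hy⟩
    obtain ⟨x, hx, rfl⟩ := hf y hy
    exact ⟨⟨x, hx⟩, rfl⟩
  refine ⟨LinearEquiv.ofBijective (f₂.restrict hJ)
    ⟨injective_of_surjective_endomorphism_submodule _ _ hsurj, hsurj⟩, ?_⟩
  rw [coe_swanMap]
  exact C.kappa_eq_of_induces hn ⟨f₂, f₁, f₀, h₁, h₀, fun _ => rfl, hε⟩

end AlgebraicTwoComplex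

/-- Left multiplication by an element of a ring, as a map of right modules. -/
def leftMulMap {R : Type*} [Ring R] (u : R) : R →ₗ[Rᵐᵒᵖ] R where
  toFun x := u * x
  map_add' := mul_add u
  map_smul' c x := by simp [mul_assoc]

/-! ### Relations between `a`, `b`, `Σ` and the partial sums -/

namespace DihedralGroup

theorem ringB_mul_ringA_sub_one (N : ℕ) :
    ringB N * (ringA N - 1) = (1 - ringA N) * (ringB N * ringA N) := by
  rw [sub_mul, one_mul, ← mul_assoc, ringA_mul_ringB_mul_ringA, mul_sub, mul_one]

theorem ringA_pow_mul_ringB_mul_ringA_pow (N i : ℕ) :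
    ringA N ^ i * ringB N * ringA N ^ i = ringB N := by
  induction i with
  | zero => simp
  | succ i ih =>
    calc ringA N ^ (i + 1) * ringB N * ringA N ^ (i + 1)
        = ringA N ^ i * (ringA N * ringB N * ringA N) * ringA N ^ i := by
          have h : ringA N * ringA N ^ i = ringA N ^ i * ringA N := (Commute.self_pow _ _).eq
          rw [pow_succ]
          simp only [mul_assoc, h]
      _ = ringB N := by rw [ringA_mul_ringB_mul_ringA, ih]

theorem partialSum_mul_ringA_sub_one (N j : ℕ) :
    partialSum N j * (ringA N - 1) = ringA N ^ j - 1 := geom_sum_mul _ _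

theorem ringA_sub_one_mul_partialSum (N j : ℕ) :
    (ringA N - 1) * partialSum N j = ringA N ^ j - 1 := mul_geom_sum _ _

theorem ringSigma_mul_ringA (N : ℕ) : ringSigma N * ringA N = ringSigma N := by
  have h : ringSigma N * (ringA N - 1) = 0 := by
    rw [ringSigma, geom_sum_mul, ringA_pow, CharP.cast_eq_zero, r_zero, map_one, sub_self]
  rwa [mul_sub, mul_one, sub_eq_zero] at h

theorem ringSigma_mul_ringA_pow (N i : ℕ) : ringSigma N * ringA N ^ i = ringSigma N := by
  induction i with
  | zero => simp
  | succ i ih => rw [pow_succ, ← mul_assoc, ih, ringSigma_mul_ringA]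

theorem ringA_mul_ringSigma (N : ℕ) : ringA N * ringSigma N = ringSigma N := by
  have h := ringA_sub_one_mul_ringSigma N
  rwa [sub_mul, one_mul, sub_eq_zero] at h

theorem ringA_pow_mul_ringSigma (N i : ℕ) : ringA N ^ i * ringSigma N = ringSigma N := by
  induction i with
  | zero => simp
  | succ i ih => rw [pow_succ, mul_assoc, ringA_mul_ringSigma, ih]

theorem ringSigma_mul_partialSum (N j : ℕ) :
    ringSigma N * partialSum N j = (j : MonoidAlgebra ℤ (DihedralGroup N)) * ringSigma N := by
  simp [partialSum, Finset.mul_sum, ringSigma_mul_ringA_pow]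

theorem partialSum_mul_ringSigma (N j : ℕ) :
    partialSum N j * ringSigma N = (j : MonoidAlgebra ℤ (DihedralGroup N)) * ringSigma N := by
  simp [partialSum, Finset.sum_mul, ringA_pow_mul_ringSigma]

/-- Conjugation by `b` inverts `a`, so it permutes the powers of `a`. -/
theorem ringB_mul_ringSigma (N : ℕ) : ringB N * ringSigma N = ringSigma N * ringB N := by
  have h : ∀ i, i ≤ N → ringB N * ringA N ^ i = ringA N ^ (N - i) * ringB N := by
    intro i hi
    have hN : ringA N ^ (N - i) * ringA N ^ i = 1 := by
      rw [← pow_add, Nat.sub_add_cancel hi, ringA_pow, CharP.cast_eq_zero, r_zero, map_one]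
    calc ringB N * ringA N ^ i
        = ringA N ^ (N - i) * ringA N ^ i * (ringB N * ringA N ^ i) := by rw [hN, one_mul]
      _ = ringA N ^ (N - i) * (ringA N ^ i * ringB N * ringA N ^ i) := by
          simp only [mul_assoc]
      _ = _ := by rw [ringA_pow_mul_ringB_mul_ringA_pow]
  -- With exponents running from 1 to `N`, the reflection `i ↦ N - 1 - i` produces exactly the
  -- exponents `N - i` of `h`.
  have hS : ringSigma N = ∑ i ∈ Finset.range N, ringA N ^ (i + 1) := by
    rw [← ringA_mul_ringSigma N, ringSigma, Finset.mul_sum]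
    exact Finset.sum_congr rfl fun i _ => (pow_succ' _ _).symm
  conv_lhs => rw [ringSigma, Finset.mul_sum]
  conv_rhs => rw [hS, ← Finset.sum_range_reflect, Finset.sum_mul]
  refine Finset.sum_congr rfl fun i hi => ?_
  have hi' := Finset.mem_range.1 hi
  rw [h i hi'.le]
  congr 2
  omega

/-! ### The two elements with `2j+1` terms -/

/-- The alternating sum `1 - b + a - a b + ⋯ + a ^ j` of `2 j + 1` group elements. -/
noncomputable def alternatingSum (N j : ℕ) : MonoidAlgebra ℤ (DihedralGroup N) :=
  partialSum N j * (1 - ringB N) + ringA N ^ j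

/-- The sum `1 + b + a + a b + ⋯ + a ^ j` of `2 j + 1` group elements. -/
noncomputable def walkSum (N j : ℕ) : MonoidAlgebra ℤ (DihedralGroup N) :=
  partialSum N j * (1 + ringB N) + ringA N ^ j

/-- Since `(1 - b)(1 + b) = 0`, only the unpaired last term survives. -/
theorem alternatingSum_mul_one_add_ringB (N j : ℕ) :
    alternatingSum N j * (1 + ringB N) = ringA N ^ j * (1 + ringB N) := by
  have h : (1 - ringB N) * (1 + ringB N) = 0 := by
    have := ringB_mul_ringB N
    simp only [sub_mul, mul_add, this, one_mul, mul_one]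
    abel
  rw [alternatingSum, add_mul, mul_assoc, h, mul_zero, zero_add]

/-- Here the sum telescopes: `(1 - b)(1 + ba) = -(a - 1)(1 + ba)`, so the paired terms contribute
`-(a^j - 1)(1 + ba)`. -/
theorem alternatingSum_mul_one_add_ringB_mul_ringA (N j : ℕ) :
    alternatingSum N j * (1 + ringB N * ringA N) = 1 + ringB N * ringA N := by
  have h : (1 - ringB N) * (1 + ringB N * ringA N) =
      (ringA N - 1) * (-1 - ringB N * ringA N) := by
    have h1 := ringB_mul_ringA_sub_one N
    have h2 : ringB N * (ringB N * ringA N) = ringA N := by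
      rw [← mul_assoc, ringB_mul_ringB, one_mul]
    calc (1 - ringB N) * (1 + ringB N * ringA N)
        = 1 + ringB N * (ringA N - 1) - ringB N * (ringB N * ringA N) := by noncomm_ring
      _ = _ := by rw [h1, h2]; noncomm_ring
  rw [alternatingSum, add_mul, mul_assoc, h, ← mul_assoc, partialSum_mul_ringA_sub_one]
  noncomm_ring

/-- Commutation of the chain map with `∂₁` on `e₁`. It rests on `(1 + b)(a - 1) = (a - 1)(1 - ba)`,
which moves `a - 1` to the left. -/
theorem walkSum_mul_ringA_sub_one (N j : ℕ) :
    walkSum N j * (ringA N - 1) =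
      (ringA N - 1) * (1 + partialSum N j * (ringA N - ringB N * ringA N)) := by
  have h : (1 + ringB N) * (ringA N - 1) = (ringA N - 1) * (1 - ringB N * ringA N) := by
    rw [add_mul, ringB_mul_ringA_sub_one]; noncomm_ring
  rw [walkSum, add_mul, mul_assoc, h, ← mul_assoc, partialSum_mul_ringA_sub_one, mul_add,
    ← mul_assoc, ringA_sub_one_mul_partialSum]
  have hc : ringA N ^ j * ringA N = ringA N * ringA N ^ j := (Commute.self_pow _ _).eq.symm
  noncomm_ring

/-- Commutation with `∂₁` on `e₂`; the pairs cancel because `(1 + b)(b - 1) = 0`. -/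
theorem walkSum_mul_ringB_sub_one (N j : ℕ) :
    walkSum N j * (ringB N - 1) =
      (ringA N - 1) * (partialSum N j * (ringB N - 1)) + (ringB N - 1) := by
  have h : (1 + ringB N) * (ringB N - 1) = 0 := by
    have := ringB_mul_ringB N
    simp only [mul_sub, add_mul, this, one_mul, mul_one]
    abel
  rw [walkSum, add_mul, mul_assoc, h, mul_zero, ← mul_assoc, ringA_sub_one_mul_partialSum]
  noncomm_ring

/-- Commutation with `∂₂` on `E₁`. As `Σ` absorbs powers of `a` and commutes with `b`, both sides
equal `jΣ(1 - b) + Σ`. -/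
theorem ringSigma_mul_alternatingSum (N j : ℕ) :
    ringSigma N * alternatingSum N j =
      (1 + partialSum N j * (ringA N - ringB N * ringA N)) * ringSigma N := by
  have h1 : ringA N * ringSigma N = ringSigma N := ringA_mul_ringSigma N
  have h2 : (ringA N - ringB N * ringA N) * ringSigma N = ringSigma N * (1 - ringB N) := by
    rw [sub_mul, mul_assoc, h1, ringB_mul_ringSigma, mul_sub, mul_one]
  rw [alternatingSum, mul_add, ← mul_assoc, ringSigma_mul_partialSum, ringSigma_mul_ringA_pow,
    add_mul, mul_assoc, mul_assoc, h2, ← mul_assoc (partialSum N j), partialSum_mul_ringSigma]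
  noncomm_ring

theorem augmentation_walkSum (N j : ℕ) : augmentation N (walkSum N j) = 2 * j + 1 := by
  have ha : augmentation N (ringA N) = 1 := augmentation_of _
  have hb : augmentation N (ringB N) = 1 := augmentation_of _
  simp [walkSum, partialSum, ha, hb]
  ring

/-! ### The right ideal generated by `1 + b` and `1 + ba` -/

/-- Membership in the right ideal generated by `1 + b` and `1 + b a`. -/
def IsReflectionSum (N : ℕ) (x : MonoidAlgebra ℤ (DihedralGroup N)) : Prop :=
  ∃ p q, x = (1 + ringB N) * p + (1 + ringB N * ringA N) * q

/-- The homomorphism `ℤ[D] → ℤ` with `a ↦ 1` and `b ↦ -1`. -/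
noncomputable def signAugmentation (N : ℕ) : MonoidAlgebra ℤ (DihedralGroup N) →ₐ[ℤ] ℤ :=
  MonoidAlgebra.lift ℤ ℤ (DihedralGroup N)
    { toFun := fun g => match g with
        | r _ => 1
        | sr _ => -1
      map_one' := rfl
      map_mul' := by rintro (i | i) (j | j) <;> simp }

theorem signAugmentation_of_r {N : ℕ} (i : ZMod N) :
    signAugmentation N (MonoidAlgebra.of ℤ _ (r i)) = 1 :=
  MonoidAlgebra.lift_of _ _

theorem signAugmentation_of_sr {N : ℕ} (i : ZMod N) :
    signAugmentation N (MonoidAlgebra.of ℤ _ (sr i)) = -1 :=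
  MonoidAlgebra.lift_of _ _

theorem signAugmentation_ringA (N : ℕ) : signAugmentation N (ringA N) = 1 :=
  signAugmentation_of_r 1

theorem signAugmentation_ringB (N : ℕ) : signAugmentation N (ringB N) = -1 :=
  signAugmentation_of_sr 0

/-- It is enough to treat `a - 1 = (1 + b)ba - (1 + ba)`, a left factor of `a^i - 1`. -/
theorem isReflectionSum_ringA_pow_sub_one (N i : ℕ) : IsReflectionSum N (ringA N ^ i - 1) := by
  have h : ringA N - 1 = (1 + ringB N) * (ringB N * ringA N) - (1 + ringB N * ringA N) := by
    rw [add_mul, ← mul_assoc (ringB N), ringB_mul_ringB]; noncomm_ring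
  refine ⟨ringB N * ringA N * partialSum N i, -partialSum N i, ?_⟩
  rw [← ringA_sub_one_mul_partialSum, h]
  noncomm_ring

/-- Modulo the ideal, `a^i` becomes 1 and `a^i b` becomes -1. Hence the ideal contains the kernel of
`signAugmentation`. -/
theorem isReflectionSum_sub_signAugmentation {N : ℕ} [NeZero N]
    (x : MonoidAlgebra ℤ (DihedralGroup N)) :
    IsReflectionSum N (x - signAugmentation N x • 1) := by
  induction x using MonoidAlgebra.induction_on with
  | of g =>
    rcases g with i | i
    · have h := isReflectionSum_ringA_pow_sub_one N i.val
      rw [ringA_pow, ZMod.natCast_zmod_val] at h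
      rwa [signAugmentation_of_r, one_smul]
    · obtain ⟨p, q, h⟩ := isReflectionSum_ringA_pow_sub_one N (-i).val
      rw [ringA_pow, ZMod.natCast_zmod_val] at h
      have e : MonoidAlgebra.of ℤ _ (sr i) = MonoidAlgebra.of ℤ _ (r (-i)) * ringB N := by
        rw [ringB, ← map_mul]; simp
      -- From `a^i b + 1 = (a^i - 1)b + (1 + b)`.
      refine ⟨p * ringB N + 1, q * ringB N, ?_⟩
      rw [signAugmentation_of_sr, e, ← sub_add_cancel (MonoidAlgebra.of ℤ _ (r (-i))) 1, h]
      noncomm_ring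
  | add x y hx hy =>
    obtain ⟨p, q, h⟩ := hx
    obtain ⟨p', q', h'⟩ := hy
    refine ⟨p + p', q + q', ?_⟩
    rw [map_add, add_smul, add_sub_add_comm, h, h']
    noncomm_ring
  | smul n x hx =>
    obtain ⟨p, q, h⟩ := hx
    refine ⟨n • p, n • q, ?_⟩
    rw [map_smul, smul_assoc, ← smul_sub, h, smul_add, mul_smul_comm, mul_smul_comm]

theorem isReflectionSum_of_mul_eq_zero {N : ℕ} [NeZero N] {x : MonoidAlgebra ℤ (DihedralGroup N)}
    (hx : (1 - ringB N * ringA N) * (ringSigma N * x) = 0) : IsReflectionSum N x := by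
  -- The sign augmentation sends `1 - ba` to 2 and `Σ` to `N`, both nonzero.
  have h : signAugmentation N x = 0 := by
    have := congrArg (signAugmentation N) hx
    simpa [signAugmentation_ringA, signAugmentation_ringB, ringSigma, NeZero.ne N] using this
  simpa [h] using isReflectionSum_sub_signAugmentation x

/-- When `2 j + 1` is prime to `N`, left multiplication by the alternating sum maps the ideal
generated by `1 + b` and `1 + b a` onto itself. -/
theorem IsReflectionSum.exists_alternatingSum_mul_eq {N j l : ℕ}
    (hl : (((2 * j + 1) * l : ℕ) : ZMod N) = 1) {y : MonoidAlgebra ℤ (DihedralGroup N)}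
    (hy : IsReflectionSum N y) :
    ∃ x, IsReflectionSum N x ∧ alternatingSum N j * x = y := by
  obtain ⟨p, q, rfl⟩ := hy
  set a := ringA N
  set b := ringB N
  -- This is where coprimality enters: `a^((2j+1)l) = a`, so `a - 1` is a right multiple of
  -- `a^(2j+1) - 1`.
  set w := ∑ i ∈ Finset.range l, (a ^ (2 * j + 1)) ^ i
  have hw : (a ^ (2 * j + 1) - 1) * w = a - 1 := by
    rw [mul_geom_sum, ← pow_mul, ringA_pow, hl]; rfl
  have h1 : a ^ j * (1 + b) * (b * a ^ (j + 1)) = a ^ (2 * j + 1) + b * a := by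
    have hb : (1 + b) * b = 1 + b := by rw [add_mul, one_mul, ringB_mul_ringB, add_comm]
    have hc := ringA_pow_mul_ringB_mul_ringA_pow N j
    calc a ^ j * (1 + b) * (b * a ^ (j + 1))
        = a ^ j * ((1 + b) * b) * a ^ (j + 1) := by simp only [mul_assoc]
      _ = a ^ j * a ^ (j + 1) + a ^ j * b * a ^ j * a := by
          rw [hb, pow_succ]; noncomm_ring
      _ = _ := by rw [hc, ← pow_add]; congr 2; ring
  have h2 : (a - 1) * (b * a) + (1 + b * a) = 1 + b := by
    have : a * (b * a) = b := by rw [← mul_assoc]; exact ringA_mul_ringB_mul_ringA N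
    rw [sub_mul, this]; noncomm_ring
  -- The choice gives `(a^(2j+1) - 1)c = (a - 1)bap = (1 + b)p - (1 + ba)p`. In the witness below,
  -- the first summand is mapped to `(a^(2j+1) + ba)c`; the `-c` in the second turns this into
  -- `(a^(2j+1) - 1)c`, and `p + q` supplies the rest.
  obtain ⟨c, hc⟩ : ∃ c, c = w * (b * a) * p := ⟨_, rfl⟩
  refine ⟨(1 + b) * (b * a ^ (j + 1) * c) + (1 + b * a) * (p + q - c), ⟨_, _, rfl⟩, ?_⟩
  rw [mul_add, ← mul_assoc (alternatingSum N j), ← mul_assoc (alternatingSum N j),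
    alternatingSum_mul_one_add_ringB, alternatingSum_mul_one_add_ringB_mul_ringA,
    ← mul_assoc _ _ c, h1]
  calc (a ^ (2 * j + 1) + b * a) * c + (1 + b * a) * (p + q - c)
      = (a ^ (2 * j + 1) - 1) * w * (b * a) * p + (1 + b * a) * p + (1 + b * a) * q := by
        rw [hc]; noncomm_ring
    _ = _ := by rw [hw, ← h2]; noncomm_ring

/-- On the two generators `alternatingSum` acts as `a^j` and as 1, and `Σ` absorbs `a^j`. -/
theorem ringSigma_mul_alternatingSum_mul {N j : ℕ} {x : MonoidAlgebra ℤ (DihedralGroup N)}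
    (hx : IsReflectionSum N x) : ringSigma N * (alternatingSum N j * x) = ringSigma N * x := by
  obtain ⟨p, q, rfl⟩ := hx
  rw [mul_add, ← mul_assoc, ← mul_assoc, alternatingSum_mul_one_add_ringB,
    alternatingSum_mul_one_add_ringB_mul_ringA, mul_add, mul_add (ringSigma N),
    mul_assoc (ringA N ^ j), ← mul_assoc (ringSigma N) (ringA N ^ j), ringSigma_mul_ringA_pow]

/-! ### The chain map with `k`-invariant `2j+1` -/

/-- Odd integers prime to `N` are `k`-invariants of automorphisms of `J`. -/
theorem exists_swanMap_cayleyComplex_eq {N n j l : ℕ} [NeZero N]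
    (hn : Nat.card (DihedralGroup N) = n) (hl : (((2 * j + 1) * l : ℕ) : ZMod N) = 1) :
    ∃ α, ((cayleyComplex N).swanMap hn α : ZMod n) = (2 * j + 1 : ℤ) := by
  set a := ringA N with ha
  set b := ringB N with hb
  set P := partialSum N j with hP
  have d₂_apply : ∀ x, (cayleyComplex N).d₂ x = ![ringSigma N * x 0 + (1 + b * a) * x 2,
      (1 + b) * x 1 + (a - 1) * x 2] := boundary₂_apply
  have d₁_apply : ∀ x, (cayleyComplex N).d₁ x = (a - 1) * x 0 + (b - 1) * x 1 := boundary₁_apply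
  have f₂_apply : ∀ x, matrixMap !![alternatingSum N j, 0, 0; 0, 1, 0; 0, 0, 1] x =
      ![alternatingSum N j * x 0, x 1, x 2] := by
    intro x
    ext i : 1
    fin_cases i <;> simp [matrixMap, dotProduct, Fin.sum_univ_three]
  have f₁_apply : ∀ x, matrixMap !![1 + P * (a - b * a), P * (b - 1); 0, 1] x =
      ![(1 + P * (a - b * a)) * x 0 + P * (b - 1) * x 1, x 1] := by
    intro x
    ext i : 1
    fin_cases i <;> simp [matrixMap, dotProduct, Fin.sum_univ_two]
  refine (cayleyComplex N).exists_swanMap_eq hn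
    (matrixMap !![alternatingSum N j, 0, 0; 0, 1, 0; 0, 0, 1])
    (matrixMap !![1 + P * (a - b * a), P * (b - 1); 0, 1]) (leftMulMap (walkSum N j)) ?_ ?_ ?_ ?_
  · intro x
    rw [f₂_apply, d₂_apply, f₁_apply, d₂_apply]
    -- `h0` and `h1` are the compatibility with `∂₂` on `E₂` and `E₃`: the terms involving `P`
    -- vanish.
    have h0 : (b - 1) * (1 + b) = 0 := by
      have : b * b = 1 := ringB_mul_ringB N
      simp only [sub_mul, mul_add, this, one_mul, mul_one]
      abel
    have h1 : (a - b * a) * (1 + b * a) + (b - 1) * (a - 1) = 0 := by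
      have h2 : a * (b * a) = b := by rw [← mul_assoc]; exact ringA_mul_ringB_mul_ringA N
      have h3 : b * b = 1 := ringB_mul_ringB N
      simp only [sub_mul, mul_add, mul_sub, mul_assoc, h2, h3, one_mul, mul_one]
      abel
    have h : (1 + P * (a - b * a)) * (ringSigma N * x 0 + (1 + b * a) * x 2) +
        P * (b - 1) * ((1 + b) * x 1 + (a - 1) * x 2) =
        (1 + P * (a - b * a)) * ringSigma N * x 0 + (1 + b * a) * x 2 +
        P * ((b - 1) * (1 + b)) * x 1 +
        P * ((a - b * a) * (1 + b * a) + (b - 1) * (a - 1)) * x 2 := by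
      noncomm_ring
    simp only [Matrix.cons_val_zero, Matrix.cons_val_one, Matrix.cons_val]
    rw [h, h0, h1, ← ringSigma_mul_alternatingSum]
    simp [mul_assoc]
  · intro x
    rw [f₁_apply, d₁_apply, d₁_apply]
    change walkSum N j * _ = _
    simp only [Matrix.cons_val_zero, Matrix.cons_val_one]
    rw [mul_add, ← mul_assoc, ← mul_assoc, walkSum_mul_ringA_sub_one, walkSum_mul_ringB_sub_one]
    simp only [mul_add, add_mul, mul_assoc, ← ha, ← hb, ← hP]
    abel
  · intro x
    change augmentation N (walkSum N j * x) = _ * augmentation N x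
    rw [map_mul, augmentation_walkSum]
  · intro y hy
    rw [d₂_apply] at hy
    have hy0 : ringSigma N * y 0 + (1 + b * a) * y 2 = 0 := congrFun hy 0
    have hM : IsReflectionSum N (y 0) := by
      apply isReflectionSum_of_mul_eq_zero
      -- Since `ba` is an involution, `1 - ba` kills `(1 + ba)y₂`, hence also `Σy₀ = -(1 + ba)y₂`.
      have h : (1 - b * a) * (1 + b * a) = 0 := by
        have h2 : b * (a * (b * a)) = 1 := by
          rw [← mul_assoc a, ringA_mul_ringB_mul_ringA, ringB_mul_ringB]
        simp only [sub_mul, mul_add, mul_assoc, h2, one_mul, mul_one]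
        abel
      rw [eq_neg_of_add_eq_zero_left hy0, mul_neg, ← mul_assoc, h, zero_mul, neg_zero]
    obtain ⟨x, hx, hxy⟩ := hM.exists_alternatingSum_mul_eq hl
    refine ⟨![x, y 1, y 2], ?_, ?_⟩
    · rw [d₂_apply, ← hy, ← hxy, ringSigma_mul_alternatingSum_mul hx]
      rfl
    · rw [f₂_apply]
      ext i : 1
      fin_cases i <;> simp [hxy]

end DihedralGroup

/-! ### Units modulo `2^m` -/

theorem corollary2p10 (m : ℕ) (hm : 2 ≤ m) :
    Function.Surjective
      ((DihedralGroup.cayleyComplex (2 ^ (m - 1))).swanMap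
        (DihedralGroup.natCard_two_pow hm)) := by
  intro κ
  have hcop : Nat.Coprime (κ : ZMod (2 ^ m)).val (2 ^ m) := ZMod.val_coe_unit_coprime κ
  have hodd : Odd (κ : ZMod (2 ^ m)).val :=
    Nat.coprime_two_right.1 (hcop.coprime_dvd_right (dvd_pow_self 2 (by omega)))
  obtain ⟨j, hj⟩ := hodd
  have hcop' : Nat.Coprime (2 * j + 1) (2 ^ (m - 1)) :=
    hj ▸ hcop.coprime_dvd_right (pow_dvd_pow 2 (Nat.sub_le m 1))
  -- The number `l` represents the inverse of `2j+1` modulo `N = 2^(m-1)`, not modulo `2^m`, since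
  -- it is used as an exponent of `a`.
  have hl : (((2 * j + 1) * ((2 * j + 1 : ℕ) : ZMod (2 ^ (m - 1)))⁻¹.val : ℕ) :
      ZMod (2 ^ (m - 1))) = 1 := by
    rw [Nat.cast_mul, ZMod.natCast_zmod_val, ZMod.coe_mul_inv_eq_one _ hcop']
  obtain ⟨α, hα⟩ := DihedralGroup.exists_swanMap_cayleyComplex_eq
    (DihedralGroup.natCard_two_pow hm) hl
  refine ⟨α, Units.ext ?_⟩
  rw [hα, ← ZMod.natCast_zmod_val (κ : ZMod (2 ^ m)), hj]
  push_cast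
  rfl
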